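/- Let $q$ be a prime power and let $f(\boldsymbol t)=\sum_{\boldsymbol i\in\mathbb N^n}a(\boldsymbol i)\boldsymbol t^{\boldsymbol i}\in\mathbb F_q[[\boldsymbol t]]$, $\boldsymbol t=(t_1,\ldots,t_n)$, be a power series that is algebraic over $\mathbb F_q(\boldsymbol t)$. Among all nonzero polynomials $A(\boldsymbol t,y)\in\mathbb F_q[\boldsymbol t,y]$ with $A(\boldsymbol t,f)=0$, let $d$ be the minimal degree in $y$ (the degree of $f$, equal to $[\mathbb F_q(\boldsymbol t)(f):\mathbb F_q(\boldsymbol t)]$), let $h_i$ be the minimal degree in $t_i$ for $1\le i\le n$ (so that $\boldsymbol h=(h_1,\ldots,h_n)$ is the partial height of $f$), and let $h$ be the minimal total degree in $\boldsymbol t$ (the total height of $f$). Set \[ N := d\cdot\min\Big\{\prod_{i=1}^n(h_i+1),\ \binom{n+h}{n}\Big\},\qquad N' := (d+1)\cdot\min\Big\{\prod_{i=1}^n(h_i+1),\ \binom{n+h}{n}\Big\}. \] For the sequence $\mathbf a=(a(\boldsymbol i))_{\boldsymbol i\in\mathbb N^n}$, let $\overleftarrow{\mathrm{comp}}_q(\mathbf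 a)$ (resp. $\overrightarrow{\mathrm{comp}}_q(\mathbf a)$) denote the least number of states of a deterministic finite automaton with output, over the alphabet $\{0,\ldots,q-1\}^n$, that generates $\mathbf a$ in reverse (resp. direct) reading: reading the base-$q$ expansions of the entries of $\boldsymbol i$, padded with leading zeros to an arbitrary common length, starting from the least (resp. most) significant digits, it outputs $a(\boldsymbol i)$. Then such automata exist, and \[ \overleftarrow{\mathrm{comp}}_q(\mathbf a)\le 1+q^{N} \qquad\text{and}\qquad \overrightarrow{\mathrm{comp}}_q(\mathbf a)\le q^{N'} . \] -/

import Mathlib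

open Polynomial

noncomputable section

namespace AlgSeries

/-- The degree in the variable `t_i` of a polynomial `A(t, y)` in `k[t, y] = k[t][y]`. -/
def degT {k : Type*} [Field k] {n : ℕ} (i : Fin n) (A : (MvPolynomial (Fin n) k)[X]) : ℕ :=
  A.support.sup fun j => (A.coeff j).degreeOf i

/-- The total degree in `t = (t_1, ..., t_n)` of a polynomial `A(t, y)` in `k[t, y] = k[t][y]`. -/
def totalDegT {k : Type*} [Field k] {n : ℕ} (A : (MvPolynomial (Fin n) k)[X]) : ℕ :=
  A.support.sup fun j => (A.coeff j).totalDegree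

/-- The nonzero polynomials `A(t, y)` with `A(t, f) = 0`. For `f` algebraic over `k(t)` this set is
nonempty, so that the minima below are attained. -/
def annihilators {k : Type*} [Field k] {n : ℕ} (f : MvPowerSeries (Fin n) k) :
    Set (MvPolynomial (Fin n) k)[X] :=
  {A | A ≠ 0 ∧ aeval f A = 0}

/-- The degree of an algebraic power series `f`: the minimal degree in `y` of a nonzero polynomial
annihilating `f`. -/
def degree {k : Type*} [Field k] {n : ℕ} (f : MvPowerSeries (Fin n) k) : ℕ :=
  sInf (Polynomial.natDegree '' annihilators f)

/-- The `i`-th partial height of an algebraic power series `f`: the minimal degree in `t_i` of a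
nonzero polynomial annihilating `f`. -/
def partialHeight {k : Type*} [Field k] {n : ℕ} (f : MvPowerSeries (Fin n) k) (i : Fin n) : ℕ :=
  sInf (degT i '' annihilators f)

/-- The total height of an algebraic power series `f`: the minimal total degree in `t` of a
nonzero polynomial annihilating `f`. -/
def totalHeight {k : Type*} [Field k] {n : ℕ} (f : MvPowerSeries (Fin n) k) : ℕ :=
  sInf (totalDegT '' annihilators f)

/-- The coefficient sequence `(a(i))`, `i ∈ ℕ^n`, of a power series. -/
def coeffSeq {k : Type*} [Field k] {n : ℕ} (f : MvPowerSeries (Fin n) k) (i : Fin n → ℕ) : k :=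
  MvPowerSeries.coeff (Finsupp.equivFunOnFinite.symm i) f

end AlgSeries

namespace Automatic

/-- A (complete) deterministic finite automaton with output: input alphabet `α`, states `σ`,
output symbols `τ`. -/
structure DFAO (α σ τ : Type*) where
  /-- the initial state -/
  start : σ
  /-- the transition function -/
  step : σ → α → σ
  /-- the output function -/
  out : σ → τ

/-- The output of the automaton after reading the word `w` from left to right. -/
def DFAO.run {α σ τ : Type*} (M : DFAO α σ τ) (w : List α) : τ :=
  M.out (w.foldl M.step M.start)

/-- The tuple of natural numbers whose base-`q` expansions, padded with zeros to a common length,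
are given by the word `w` of digit tuples, most significant digits first. -/
def value {q n : ℕ} (w : List (Fin n → Fin q)) (j : Fin n) : ℕ :=
  w.foldl (fun m c => q * m + (c j : ℕ)) 0

/-- `M` generates `a` in direct reading (most significant digits first). The output has to be
correct on every expansion of the input, whatever the number of leading zeros. -/
def GeneratesDirect {q n : ℕ} {σ τ : Type*} (M : DFAO (Fin n → Fin q) σ τ)
    (a : (Fin n → ℕ) → τ) : Prop :=
  ∀ w : List (Fin n → Fin q), M.run w = a (value w)

/-- `M` generates `a` in reverse reading (least significant digits first). The output has to be
correct on every expansion of the input, whatever the number of leading zeros. -/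
def GeneratesReverse {q n : ℕ} {σ τ : Type*} (M : DFAO (Fin n → Fin q) σ τ)
    (a : (Fin n → ℕ) → τ) : Prop :=
  ∀ w : List (Fin n → Fin q), M.run w.reverse = a (value w)

/-- The direct-reading state complexity: the least number of states of an automaton generating `a`
in direct reading, and `⊤` if there is no finite one. -/
def compDirect (q : ℕ) {n : ℕ} {τ : Type*} (a : (Fin n → ℕ) → τ) : ℕ∞ :=
  ⨅ (m : ℕ) (_ : ∃ M : DFAO (Fin n → Fin q) (Fin m) τ, GeneratesDirect M a), (m : ℕ∞)

/-- The reverse-reading state complexity: the least number of states of an automaton generating `a`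
in reverse reading, and `⊤` if there is no finite one. -/
def compReverse (q : ℕ) {n : ℕ} {τ : Type*} (a : (Fin n → ℕ) → τ) : ℕ∞ :=
  ⨅ (m : ℕ) (_ : ∃ M : DFAO (Fin n → Fin q) (Fin m) τ, GeneratesReverse M a), (m : ℕ∞)

end Automatic

end

/-! ### Sections of power series over a finite field -/

namespace MvPowerSeries

variable {F σ : Type*} [Field F]

/-! The annihilating polynomials of `f` are the multiples of a single `E`
(`exists_dvd_of_aeval_eq_zero`). Degrees are monotone under divisibility, so `E` attains the minimal
degree in `y`, all partial heights and the total height simultaneously. Moreover `E_y(f) ≠ 0`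
(`aeval_derivative_ne_zero`).

Let `W` be the space of series `P(f) / E_y(f)` with `deg P < deg E` and the exponents of the
coefficients of `P` in the box given by the heights. It has at most `q ^ N` elements and contains
`f`. It is stable under the section operators: if `g * E_y(f) = P(f)`, then `g * E_y(f) ^ q` is the
coefficient of `u ^ (q - 1)` in `(P * E ^ (q - 1))(f + u)`, and the section of such a coefficient is
again a polynomial in `f` (`sec_coeff_taylor`, `sec_mul_derivative`). Taking the section divides
degrees and heights by `q`, which exactly undoes their growth.

A reverse automaton has the elements of `W` as states, and a direct one has the elements of the dual
of `W`, which is equally large. Both complexities are thus at most `q ^ N`, which is stronger than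
the two bounds claimed. -/

/-- The section operator extracting from a power series the coefficients with exponents congruent
to `r` modulo `q`. -/
noncomputable def sec (q : ℕ) (r : σ →₀ ℕ) : MvPowerSeries σ F →ₗ[F] MvPowerSeries σ F where
  toFun g := fun m => coeff (q • m + r) g
  map_add' _ _ := rfl
  map_smul' _ _ := rfl

theorem coeff_sec (q : ℕ) (r m : σ →₀ ℕ) (g : MvPowerSeries σ F) :
    coeff m (sec q r g) = coeff (q • m + r) g := rfl

variable [Finite F] {q : ℕ}

/-- The `q`-th power Frobenius fixes the coefficients, so it acts only on the exponents. -/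
theorem pow_card_eq_expand (hq : Nat.card F = q) (hq0 : q ≠ 0) (g : MvPowerSeries σ F) :
    g ^ q = expand q hq0 g := by
  have := Fintype.ofFinite F
  obtain ⟨p, hp⟩ := CharP.exists F
  obtain ⟨k, hp', hk⟩ := FiniteField.card F p
  have : Fact p.Prime := ⟨hp'⟩
  have : ExpChar F p := ExpChar.prime hp'
  have hqk : q = p ^ (k : ℕ) := by rw [← hq, Nat.card_eq_fintype_card, hk]
  subst hqk
  rw [← map_iterateFrobenius_expand p hp'.ne_zero g k]
  ext m
  rw [coeff_map, iterateFrobenius_def]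
  simpa only [hk] using FiniteField.pow_card (coeff m (expand (p ^ (k : ℕ)) hq0 g))

/-- The exponents of `a ^ q` are multiples of `q`. Since `r < q` entrywise, `q • u + v = q • m + r`
forces `u ≤ m` and `v = q • (m - u) + r`. -/
theorem sec_pow_mul (hq : Nat.card F = q) {r : σ →₀ ℕ} (hr : ∀ i, r i < q)
    (a g : MvPowerSeries σ F) : sec q r (a ^ q * g) = a * sec q r g := by
  classical
  have hq0 : q ≠ 0 := by rw [← hq]; exact Nat.card_pos.ne'
  ext m
  rw [coeff_sec, pow_card_eq_expand hq hq0, coeff_mul, coeff_mul]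
  symm
  refine Finset.sum_of_injOn (fun u => (q • u.1, q • u.2 + r)) ?_ ?_ ?_ ?_
  · rintro ⟨u, v⟩ - ⟨u', v'⟩ - h
    simp only [Prod.mk.injEq, add_left_inj, nsmul_right_inj hq0] at h
    simpa using h
  · rintro ⟨u, v⟩ h
    rw [Finset.mem_coe, Finset.HasAntidiagonal.mem_antidiagonal] at h ⊢
    simp only at h ⊢
    rw [← add_assoc, ← smul_add, h]
  · rintro ⟨u, v⟩ h h'
    simp only [Finset.HasAntidiagonal.mem_antidiagonal] at h
    by_cases hu : ∀ i, q ∣ u i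
    · exfalso
      apply h'
      choose w hw using hu
      have hle : ∀ i, u i ≤ q * m i := fun i => by
        have h1 := DFunLike.congr_fun h i
        simp only [Finsupp.add_apply, Finsupp.smul_apply, smul_eq_mul] at h1
        have h2 := hr i
        rw [hw i] at h1 ⊢
        have : w i < m i + 1 := by
          by_contra hcon
          have := Nat.mul_le_mul_left q (not_lt.mp hcon)
          rw [mul_add] at this
          omega
        exact Nat.mul_le_mul_left q (by omega)
      have hq1 : 0 < q := Nat.pos_of_ne_zero hq0
      have hwm : ∀ i, w i ≤ m i := fun i => by
        have := hle i
        rw [hw i] at this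
        exact Nat.le_of_mul_le_mul_left this hq1
      let w' : σ →₀ ℕ := u.mapRange (fun x => x / q) (Nat.zero_div q)
      have hw' : ∀ i, w' i = w i := fun i => by
        simp [w', hw i, Nat.mul_div_cancel_left _ hq1]
      refine ⟨(w', m - w'), ?_, ?_⟩
      · rw [Finset.mem_coe, Finset.HasAntidiagonal.mem_antidiagonal]
        ext i
        simp [hw', hwm]
      · simp only [Prod.mk.injEq]
        constructor
        · ext i
          simp [hw', hw i]
        · ext i
          have h1 := DFunLike.congr_fun h i
          have h2 := Nat.mul_le_mul_left q (hwm i)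
          simp only [Finsupp.add_apply, Finsupp.smul_apply, smul_eq_mul, Finsupp.tsub_apply, hw',
            Nat.mul_sub, hw i] at h1 ⊢
          omega
    · push Not at hu
      obtain ⟨i, hi⟩ := hu
      rw [coeff_expand_of_not_dvd _ _ _ hi, zero_mul]
  · rintro ⟨u, v⟩ -
    rw [coeff_expand_smul, coeff_sec]

end MvPowerSeries

/-! ### A binomial coefficient computation in characteristic `p` -/

namespace Polynomial

/-- By Frobenius the power is `(X ^ p ^ k + c ^ p ^ k) ^ j * (X + c) ^ s`. Below degree `p ^ k` only
the constant term of the first factor matters, and the second has degree `s`. -/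
theorem coeff_X_add_C_pow_card {A : Type*} [CommRing A] (p k : ℕ) [ExpChar A p]
    (c : A) {j s : ℕ} (hs : s < p ^ k) :
    ((X + C c) ^ (p ^ k * j + s)).coeff (p ^ k - 1) = if s = p ^ k - 1 then c ^ (p ^ k * j) else 0 := by
  have h1 : (X + C c : A[X]) ^ (p ^ k * j + s)
      = (X ^ p ^ k + C (c ^ p ^ k)) ^ j * (X + C c) ^ s := by
    rw [pow_add, pow_mul, add_pow_expChar_pow, C_pow]
  obtain ⟨B, hB⟩ : (X ^ p ^ k : A[X]) ∣ (X ^ p ^ k + C (c ^ p ^ k)) ^ j - C (c ^ p ^ k) ^ j := by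
    have := sub_dvd_pow_sub_pow (X ^ p ^ k + C (c ^ p ^ k) : A[X]) (C (c ^ p ^ k)) j
    rwa [add_sub_cancel_right] at this
  rw [h1, eq_add_of_sub_eq hB, add_mul, coeff_add, mul_assoc, coeff_X_pow_mul', if_neg (by omega),
    zero_add, ← C_pow, coeff_C_mul, coeff_X_add_C_pow, ← pow_mul]
  split_ifs with h
  · subst h
    simp
  · rw [Nat.choose_eq_zero_of_lt (by omega)]
    simp

end Polynomial

/-! ### Sections of Taylor coefficients -/

namespace SectionOperator

open MvPowerSeries (sec sec_pow_mul coeff_sec)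

variable {F σ : Type*} [Field F] {q : ℕ}

/-- The polynomial whose `j`-th coefficient is the `r`-section of the coefficient of
`y ^ (q * j + (q - 1))` of `B`. -/
noncomputable def secPoly (q : ℕ) (r : σ →₀ ℕ) (B : (MvPowerSeries σ F)[X]) :
    (MvPowerSeries σ F)[X] :=
  ∑ j ∈ Finset.range (B.natDegree + 1), monomial j (sec q r (B.coeff (q * j + (q - 1))))

theorem coeff_secPoly (hq : 0 < q) (r : σ →₀ ℕ) (B : (MvPowerSeries σ F)[X]) (j : ℕ) :
    (secPoly q r B).coeff j = sec q r (B.coeff (q * j + (q - 1))) := by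
  simp only [secPoly, finsetSum_coeff, Polynomial.coeff_monomial, Finset.sum_ite_eq',
    Finset.mem_range]
  split_ifs with h
  · rfl
  · rw [coeff_eq_zero_of_natDegree_lt, map_zero]
    have := Nat.le_mul_of_pos_left j hq
    omega

theorem secPoly_add (hq : 0 < q) (r : σ →₀ ℕ) (A B : (MvPowerSeries σ F)[X]) :
    secPoly q r (A + B) = secPoly q r A + secPoly q r B := by
  ext1 j
  simp [coeff_secPoly hq]

theorem secPoly_monomial (hq : 0 < q) (r : σ →₀ ℕ) (j s : ℕ) (hs : s < q) (a : MvPowerSeries σ F) :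
    secPoly q r (monomial (q * j + s) a) = if s = q - 1 then monomial j (sec q r a) else 0 := by
  ext1 i
  rw [coeff_secPoly hq, Polynomial.coeff_monomial]
  have key : q * j + s = q * i + (q - 1) ↔ s = q - 1 ∧ j = i := by
    constructor
    · intro h
      have h1 := congrArg (· % q) h
      simp only [Nat.mul_add_mod, Nat.mod_eq_of_lt hs, Nat.mod_eq_of_lt (Nat.sub_lt hq one_pos)] at h1
      refine ⟨h1, ?_⟩
      rw [h1] at h
      exact Nat.eq_of_mul_eq_mul_left hq (Nat.add_right_cancel h)
    · rintro ⟨rfl, rfl⟩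
      rfl
  by_cases h1 : s = q - 1
  · by_cases h2 : j = i
    · rw [if_pos (key.2 ⟨h1, h2⟩), if_pos h1, Polynomial.coeff_monomial, if_pos h2]
    · rw [if_neg (fun h => h2 (key.1 h).2), if_pos h1, Polynomial.coeff_monomial, if_neg h2,
        map_zero]
  · rw [if_neg (fun h => h1 (key.1 h).1), if_neg h1, Polynomial.coeff_zero, map_zero]

/-- Sections of the coefficient of `u ^ (q - 1)` in `B (f + u)`. -/
theorem sec_coeff_taylor [Finite F] (hq : Nat.card F = q) {r : σ →₀ ℕ} (hr : ∀ i, r i < q)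
    (f : MvPowerSeries σ F) (B : (MvPowerSeries σ F)[X]) :
    sec q r ((taylor f B).coeff (q - 1)) = (secPoly q r B).eval f := by
  have hq0 : 0 < q := by rw [← hq]; exact Nat.card_pos
  induction B using Polynomial.induction_on' with
  | add A B hA hB => rw [secPoly_add hq0, map_add, Polynomial.coeff_add, map_add, hA, hB, eval_add]
  | monomial m a =>
    have := Fintype.ofFinite F
    obtain ⟨p, hp⟩ := CharP.exists F
    obtain ⟨k, hp', hk⟩ := FiniteField.card F p
    have : CharP (MvPowerSeries σ F) p := charP_of_injective_ringHom
      (f := (MvPowerSeries.C : F →+* MvPowerSeries σ F)) MvPowerSeries.C_injective p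
    have : ExpChar (MvPowerSeries σ F) p := ExpChar.prime hp'
    have hqk : q = p ^ (k : ℕ) := by rw [← hq, Nat.card_eq_fintype_card, hk]
    obtain ⟨j, s, hs, rfl⟩ : ∃ j s, s < q ∧ m = q * j + s :=
      ⟨m / q, m % q, Nat.mod_lt _ hq0, (Nat.div_add_mod m q).symm⟩
    rw [secPoly_monomial hq0 r j s hs, taylor_monomial, Polynomial.coeff_C_mul]
    have key := Polynomial.coeff_X_add_C_pow_card p k f (j := j) (s := s) (hqk ▸ hs)
    rw [← hqk] at key
    rw [key]
    split_ifs with h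
    -- The surviving Taylor coefficient is `a * (f ^ j) ^ q`, and the `q`-th power leaves the
    -- section as `f ^ j`.
    · rw [eval_monomial, mul_comm q j, pow_mul, mul_comm, sec_pow_mul hq hr, mul_comm]
    · simp

/-- Since `E(f) = 0`, `E(f + u) = u * G(u)` with `G(0) = E_y(f)`. Hence the `u ^ (q - 1)`
coefficient of `(P * E ^ (q - 1))(f + u)` is `P(f) * E_y(f) ^ (q - 1) = g * E_y(f) ^ q`. -/
theorem sec_mul_derivative [Finite F] (hq : Nat.card F = q) {r : σ →₀ ℕ} (hr : ∀ i, r i < q)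
    {f g : MvPowerSeries σ F} {E P : (MvPowerSeries σ F)[X]} (hE : E.eval f = 0)
    (hg : g * (derivative E).eval f = P.eval f) :
    sec q r g * (derivative E).eval f = (secPoly q r (P * E ^ (q - 1))).eval f := by
  have hq0 : 0 < q := by rw [← hq]; exact Nat.card_pos
  rw [← sec_coeff_taylor hq hr]
  obtain ⟨G, hG⟩ : X ∣ taylor f E := by
    rw [X_dvd_iff, taylor_coeff_zero, hE]
  have hG0 : G.coeff 0 = (derivative E).eval f := by
    rw [← taylor_coeff_one, hG, coeff_X_mul]
  have h1 : (taylor f (P * E ^ (q - 1))).coeff (q - 1)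
      = (derivative E).eval f ^ q * g := by
    rw [taylor_mul, taylor_pow, hG, mul_pow, mul_left_comm, coeff_X_pow_mul', if_pos le_rfl,
      Nat.sub_self, mul_coeff_zero, taylor_coeff_zero, ← hg, coeff_zero_eq_eval_zero (G ^ _),
      eval_pow, ← coeff_zero_eq_eval_zero, hG0, mul_assoc, ← pow_succ', Nat.sub_add_cancel hq0,
      mul_comm]
  rw [h1, sec_pow_mul hq hr, mul_comm]

end SectionOperator

/-! ### The minimal polynomial and its heights -/

namespace Polynomial

/-- Over a factorial domain, the annihilating polynomials of an algebraic element are the multiples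
of a single one. -/
theorem exists_dvd_of_aeval_eq_zero {R L : Type*} [CommRing R] [IsDomain R]
    [UniqueFactorizationMonoid R] [CommRing L] [IsDomain L] [Algebra R L]
    (hinj : Function.Injective (algebraMap R L)) {f : L} (hf : IsAlgebraic R f) :
    ∃ E : R[X], E ≠ 0 ∧ aeval f E = 0 ∧ ∀ A : R[X], aeval f A = 0 → E ∣ A := by
  classical
  obtain ⟨A₀, hA₀, hA₀f⟩ := hf
  have hI : RingHom.ker (aeval f : R[X] →ₐ[R] L) ≠ ⊥ := fun h =>
    hA₀ (by rwa [← RingHom.mem_ker, h, Ideal.mem_bot] at hA₀f)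
  -- The kernel is a nonzero prime ideal of a factorial ring, so it contains a prime element.
  obtain ⟨E, hEI, hE⟩ := Ideal.IsPrime.exists_mem_prime_of_ne_bot
    (RingHom.ker_isPrime (aeval f : R[X] →ₐ[R] L)) hI
  rw [RingHom.mem_ker] at hEI
  have hdeg : E.natDegree ≠ 0 := fun h => by
    rw [natDegree_eq_zero] at h
    obtain ⟨c, rfl⟩ := h
    rw [aeval_C, map_eq_zero_iff _ hinj] at hEI
    exact hE.ne_zero (by rw [hEI, C_0])
  refine ⟨E, hE.ne_zero, hEI, fun A hA => ?_⟩
  let K := FractionRing R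
  let φ : K →+* FractionRing L := IsFractionRing.map hinj
  have hφ : ∀ B : R[X], (B.map (algebraMap R K)).eval₂ φ (algebraMap L _ f)
      = algebraMap L (FractionRing L) (aeval f B) := fun B => by
    rw [eval₂_map, aeval_def, hom_eval₂]
    congr 1
    ext x
    simp [φ, K, IsFractionRing.map]
  have hprim := hE.irreducible.isPrimitive hdeg
  have hirr := (hprim.irreducible_iff_irreducible_map_fraction_map (K := K)).1 hE.irreducible
  refine hprim.dvd_of_fraction_map_dvd_fraction_map (K := K) ?_
  -- By Gauss's lemma divisibility may be tested over the fraction field; there a Bézout relation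
  -- evaluated at `f` would read `0 = 1`.
  by_contra hnd
  obtain ⟨u, v, huv⟩ := (hirr.coprime_iff_not_dvd).2 hnd
  have := congrArg (eval₂ φ (algebraMap L _ f)) huv
  simp [eval₂_add, eval₂_mul, hφ, hEI, hA] at this

/-- A degree function on a domain, extended to polynomials by taking the maximum over the
coefficients, does not decrease under multiplication by a nonzero polynomial. -/
theorem sup_support_le_mul {R : Type*} [CommRing R] [IsDomain R] (D : R → ℕ)
    (hmul : ∀ a b, a ≠ 0 → b ≠ 0 → D (a * b) = D a + D b)
    (hadd : ∀ a b, D (a + b) ≤ max (D a) (D b)) (hneg : ∀ a, D (-a) = D a)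
    {A B : R[X]} (hA : A ≠ 0) (hB : B ≠ 0) :
    (A.support.sup fun j => D (A.coeff j)) ≤ (A * B).support.sup fun j => D ((A * B).coeff j) := by
  classical
  have hex : ∀ P : R[X], P ≠ 0 → ∃ j, P.coeff j ≠ 0 ∧
      D (P.coeff j) = P.support.sup fun j => D (P.coeff j) := fun P hP => by
    obtain ⟨j, hj, h⟩ := Finset.exists_mem_eq_sup P.support (support_nonempty.2 hP)
      fun j => D (P.coeff j)
    exact ⟨j, mem_support_iff.1 hj, h.symm⟩
  set a := A.support.sup fun j => D (A.coeff j) with ha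
  set b := B.support.sup fun j => D (B.coeff j) with hb
  have hle : ∀ (P : R[X]) (j : ℕ), P.coeff j ≠ 0 →
      D (P.coeff j) ≤ P.support.sup fun j => D (P.coeff j) := fun P j h =>
    Finset.le_sup (f := fun j => D (P.coeff j)) (mem_support_iff.2 h)
  obtain ⟨hj0, hj1⟩ := Nat.find_spec (hex A hA)
  have hjmin := fun m => Nat.find_min (m := m) (hex A hA)
  obtain ⟨hk0, hk1⟩ := Nat.find_spec (hex B hB)
  have hkmin := fun m => Nat.find_min (m := m) (hex B hB)
  set j := Nat.find (hex A hA)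
  set k := Nat.find (hex B hB)
  by_contra! hlt
  -- Since `j` and `k` are the least indices attaining the maxima `a` and `b`, every other term of
  -- the coefficient at `j + k` lies in `V`, whereas `A.coeff j * B.coeff k` does not. Zero is
  -- admitted separately because `D 0` is arbitrary.
  let V : AddSubgroup R :=
    { carrier := {x | x = 0 ∨ D x < a + b}
      zero_mem' := Or.inl rfl
      add_mem' := by
        rintro x y (rfl | hx) (rfl | hy)
        · exact Or.inl (add_zero 0)
        · exact Or.inr (by rwa [zero_add])
        · exact Or.inr (by rwa [add_zero])
        · exact Or.inr ((hadd x y).trans_lt (max_lt hx hy))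
      neg_mem' := by
        rintro x (rfl | hx)
        · exact Or.inl neg_zero
        · exact Or.inr (by rwa [hneg]) }
  have h1 : (A * B).coeff (j + k) ∈ V := by
    by_cases h : (A * B).coeff (j + k) = 0
    · exact Or.inl h
    · exact Or.inr ((hle _ _ h).trans_lt (by omega))
  have h2 : A.coeff j * B.coeff k ∈ V := by
    rw [coeff_mul, ← Finset.add_sum_erase _ _ (a := (j, k)) (by simp)] at h1
    refine (V.add_mem_cancel_right (V.sum_mem ?_)).1 h1
    rintro ⟨u, v⟩ huv
    simp only [Finset.mem_erase, Finset.HasAntidiagonal.mem_antidiagonal, ne_eq, Prod.mk.injEq]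
      at huv
    by_cases hu : A.coeff u = 0
    · exact Or.inl (by simp [hu])
    by_cases hv : B.coeff v = 0
    · exact Or.inl (by simp [hv])
    refine Or.inr ?_
    simp only
    rw [hmul _ _ hu hv]
    have h3 := hle A u hu
    have h4 := hle B v hv
    rcases lt_or_ge u j with h | h
    · have : D (A.coeff u) ≠ a := fun h' => hjmin u h ⟨hu, h'⟩
      omega
    · have hvk : v < k := by omega
      have : D (B.coeff v) ≠ b := fun h' => hkmin v hvk ⟨hv, h'⟩
      omega
  rcases h2 with h2 | h2
  · exact mul_ne_zero hj0 hk0 h2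
  · rw [hmul _ _ hj0 hk0, hj1, hk1] at h2
    exact lt_irrefl _ h2

end Polynomial

namespace AlgSeries

variable {k : Type*} [Field k] {n : ℕ}

theorem degT_le_of_dvd (i : Fin n) {A B : (MvPolynomial (Fin n) k)[X]} (hB : B ≠ 0) (h : A ∣ B) :
    degT i A ≤ degT i B := by
  obtain ⟨Q, hQ⟩ := h
  have hA0 : A ≠ 0 := fun h => hB (by rw [hQ, h, zero_mul])
  have hQ0 : Q ≠ 0 := fun h => hB (by rw [hQ, h, mul_zero])
  have key := Polynomial.sup_support_le_mul (MvPolynomial.degreeOf (R := k) i)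
    (fun a b ha hb => MvPolynomial.degreeOf_mul_eq ha hb)
    (fun a b => MvPolynomial.degreeOf_add_le i a b)
    (fun a => by rw [MvPolynomial.degreeOf_eq_sup, MvPolynomial.support_neg,
      MvPolynomial.degreeOf_eq_sup]) hA0 hQ0
  rw [← hQ] at key
  exact key

theorem totalDegT_le_of_dvd {A B : (MvPolynomial (Fin n) k)[X]} (hB : B ≠ 0) (h : A ∣ B) :
    totalDegT A ≤ totalDegT B := by
  obtain ⟨Q, hQ⟩ := h
  have hA0 : A ≠ 0 := fun h => hB (by rw [hQ, h, zero_mul])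
  have hQ0 : Q ≠ 0 := fun h => hB (by rw [hQ, h, mul_zero])
  have key := Polynomial.sup_support_le_mul (MvPolynomial.totalDegree (R := k) (σ := Fin n))
    (fun a b ha hb => MvPolynomial.totalDegree_mul_of_isDomain ha hb)
    MvPolynomial.totalDegree_add MvPolynomial.totalDegree_neg hA0 hQ0
  rw [← hQ] at key
  exact key

end AlgSeries

/-! ### Separability -/

namespace SectionOperator

open MvPowerSeries (sec sec_pow_mul coeff_sec)

variable {F σ : Type*} [Field F] {q : ℕ}

theorem algebraMap_eq_coe (c : MvPolynomial σ F) :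
    algebraMap (MvPolynomial σ F) (MvPowerSeries σ F) c = (c : MvPowerSeries σ F) := by
  rw [MvPowerSeries.algebraMap_apply', Algebra.algebraMap_self, MvPowerSeries.map_id]
  rfl

theorem algebraMap_injective :
    Function.Injective (algebraMap (MvPolynomial σ F) (MvPowerSeries σ F)) := fun a b h => by
  rw [algebraMap_eq_coe, algebraMap_eq_coe] at h
  exact MvPolynomial.coe_injective σ F h

theorem exists_coe_eq_sec (hq0 : q ≠ 0) (r : σ →₀ ℕ) (c : MvPolynomial σ F) :
    ∃ c' : MvPolynomial σ F, (c' : MvPowerSeries σ F) = sec q r (c : MvPowerSeries σ F) := by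
  have hfin : (Function.support fun m => MvPolynomial.coeff (q • m + r) c).Finite := by
    refine Set.Finite.subset (c.support.finite_toSet.preimage
      (f := fun m : σ →₀ ℕ => q • m + r) ?_) ?_
    · intro u _ v _ h
      simpa [nsmul_right_inj hq0] using h
    · intro m hm
      simpa using hm
  refine ⟨∑ m ∈ hfin.toFinset, MvPolynomial.monomial m (MvPolynomial.coeff (q • m + r) c), ?_⟩
  classical
  ext m
  rw [coeff_sec, MvPolynomial.coeff_coe, MvPolynomial.coeff_coe, MvPolynomial.coeff_sum]
  simp only [MvPolynomial.coeff_monomial, Finset.sum_ite_eq', Set.Finite.mem_toFinset,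
    Function.mem_support, ne_eq, ite_not]
  split_ifs with h
  · exact h.symm
  · rfl

theorem eq_zero_of_sec_eq_zero (hq0 : 0 < q) {g : MvPowerSeries σ F}
    (h : ∀ r : σ →₀ ℕ, (∀ i, r i < q) → sec q r g = 0) : g = 0 := by
  ext m
  have := congrArg (MvPowerSeries.coeff (m.mapRange (fun x => x / q) (Nat.zero_div q)))
    (h (m.mapRange (fun x => x % q) (Nat.zero_mod q)) fun i => by
      simpa using Nat.mod_lt _ hq0)
  have hm : q • m.mapRange (fun x => x / q) (Nat.zero_div q)
      + m.mapRange (fun x => x % q) (Nat.zero_mod q) = m := by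
    ext i
    simp [Nat.div_add_mod]
  rw [coeff_sec, hm] at this
  rw [this, map_zero, map_zero]

/-- An algebraic power series over a finite field is separable. -/
theorem aeval_derivative_ne_zero [Finite F] {f : MvPowerSeries σ F}
    {E : (MvPolynomial σ F)[X]} (hE : E ≠ 0) (hEf : aeval f E = 0)
    (hdvd : ∀ A : (MvPolynomial σ F)[X], aeval f A = 0 → E ∣ A) :
    aeval f (derivative E) ≠ 0 := by
  intro hder
  have hd0 : derivative E = 0 :=
    eq_zero_of_dvd_of_degree_lt (hdvd _ hder) (degree_derivative_lt hE)
  have := Fintype.ofFinite F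
  obtain ⟨p, hp⟩ := CharP.exists F
  obtain ⟨k, hp', hk⟩ := FiniteField.card F p
  have : ExpChar (MvPolynomial σ F) p := ExpChar.prime hp'
  obtain ⟨l, hl⟩ : ∃ l, (k : ℕ) = l + 1 := ⟨k - 1, (Nat.sub_add_cancel k.pos).symm⟩
  have hq : Nat.card F = p ^ l * p := by rw [Nat.card_eq_fintype_card, hk, hl, pow_succ]
  have hq0 : 0 < p ^ l * p := hq ▸ Nat.card_pos
  -- With `E` a polynomial in `y ^ p` and `q = p ^ l * p`, the power `E ^ p ^ l` is a polynomial `H`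
  -- in `y ^ q`.
  set H : (MvPolynomial σ F)[X] :=
    (contract p E).map (iterateFrobenius (MvPolynomial σ F) p l) with hH
  have hpow : E ^ p ^ l = expand _ (p ^ l * p) H := by
    rw [← Polynomial.map_iterateFrobenius_expand p E l, hH, ← Polynomial.map_expand, expand_mul,
      expand_contract p hd0 hp'.ne_zero]
  have hH0 : H ≠ 0 := fun h => pow_ne_zero (p ^ l) hE (by rw [hpow, h, map_zero])
  have hEdeg : E.natDegree ≠ 0 := fun h => by
    rw [natDegree_eq_zero] at h
    obtain ⟨c, rfl⟩ := h
    rw [aeval_C, map_eq_zero_iff _ algebraMap_injective] at hEf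
    exact hE (by rw [hEf, C_0])
  have hHdeg : H.natDegree < E.natDegree := by
    have h1 := congrArg natDegree hpow
    rw [natDegree_pow, natDegree_expand, mul_comm, mul_comm (p ^ l), ← mul_assoc] at h1
    have h2 := Nat.eq_of_mul_eq_mul_right (pow_pos hp'.pos l) h1
    have h3 := hp'.two_le
    nlinarith [Nat.pos_of_ne_zero hEdeg]
  -- Sections of `H(f ^ q) = 0` are relations for `f` of degree at most `deg H = deg E / p < deg E`.
  -- They must be trivial, so every section of every coefficient of `H` vanishes, contradicting `H ≠
  -- 0`.
  have hsum : ∀ r : σ →₀ ℕ, (∀ i, r i < p ^ l * p) →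
      ∑ j ∈ Finset.range (H.natDegree + 1),
        sec (p ^ l * p) r (H.coeff j : MvPowerSeries σ F) * f ^ j = 0 := fun r hr => by
    have h1 : aeval f (E ^ p ^ l) = 0 := by
      rw [map_pow, hEf, zero_pow (pow_pos hp'.pos l).ne']
    rw [hpow, expand_aeval, aeval_eq_sum_range] at h1
    have h2 := congrArg (sec (p ^ l * p) r) h1
    rw [map_zero, map_sum] at h2
    rw [← h2]
    refine Finset.sum_congr rfl fun j _ => ?_
    rw [Algebra.smul_def, algebraMap_eq_coe, ← pow_mul, mul_comm (p ^ l * p), pow_mul, mul_comm,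
      mul_comm (H.coeff j : MvPowerSeries σ F), sec_pow_mul hq hr]
  apply hH0
  ext1 j
  apply MvPolynomial.coe_injective
  rw [Polynomial.coeff_zero, MvPolynomial.coe_zero]
  refine eq_zero_of_sec_eq_zero hq0 fun r hr => ?_
  choose c hc using fun j => exists_coe_eq_sec hq0.ne' r (H.coeff j)
  set A : (MvPolynomial σ F)[X] := ∑ j ∈ Finset.range (H.natDegree + 1), monomial j (c j) with hA
  have hAf : aeval f A = 0 := by
    rw [hA, map_sum, ← hsum r hr]
    refine Finset.sum_congr rfl fun j _ => ?_
    rw [aeval_monomial, algebraMap_eq_coe, hc]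
  have hA0 : A = 0 := by
    refine eq_zero_of_dvd_of_natDegree_lt (hdvd A hAf) (lt_of_le_of_lt ?_ hHdeg)
    refine natDegree_sum_le_of_forall_le _ _ fun i hi => (natDegree_monomial_le _).trans ?_
    exact Nat.lt_succ_iff.1 (Finset.mem_range.1 hi)
  by_cases hj : j ≤ H.natDegree
  · have := congrArg (fun P => Polynomial.coeff P j) hA0
    simp only [hA, finsetSum_coeff, Polynomial.coeff_monomial, Finset.sum_ite_eq',
      Finset.mem_range, Nat.lt_succ_iff, hj, if_true, Polynomial.coeff_zero] at this
    rw [← hc, this, MvPolynomial.coe_zero]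
  · rw [coeff_eq_zero_of_natDegree_lt (by omega), MvPolynomial.coe_zero, map_zero]

end SectionOperator

/-! ### Automata from spaces stable under sections -/

namespace Automatic

variable {q n : ℕ} {σ τ : Type*}

theorem compReverse_le_card [Finite σ] {a : (Fin n → ℕ) → τ} (M : DFAO (Fin n → Fin q) σ τ)
    (hM : GeneratesReverse M a) : compReverse q a ≤ (Nat.card σ : ℕ∞) := by
  let e := Finite.equivFin σ
  refine iInf₂_le (Nat.card σ)
    ⟨⟨e M.start, fun s c => e (M.step (e.symm s) c), fun s => M.out (e.symm s)⟩, fun w => ?_⟩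
  have key : ∀ (w : List (Fin n → Fin q)) (s : σ),
      w.foldl (fun s c => e (M.step (e.symm s) c)) (e s) = e (w.foldl M.step s) := by
    intro w
    induction w with
    | nil => exact fun s => rfl
    | cons c w ih => exact fun s => by simp only [List.foldl_cons, Equiv.symm_apply_apply, ih]
  rw [← hM w, DFAO.run, DFAO.run, key]
  exact congrArg M.out (e.symm_apply_apply _)

theorem compDirect_le_card [Finite σ] {a : (Fin n → ℕ) → τ} (M : DFAO (Fin n → Fin q) σ τ)
    (hM : GeneratesDirect M a) : compDirect q a ≤ (Nat.card σ : ℕ∞) := by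
  let e := Finite.equivFin σ
  refine iInf₂_le (Nat.card σ)
    ⟨⟨e M.start, fun s c => e (M.step (e.symm s) c), fun s => M.out (e.symm s)⟩, fun w => ?_⟩
  have key : ∀ (w : List (Fin n → Fin q)) (s : σ),
      w.foldl (fun s c => e (M.step (e.symm s) c)) (e s) = e (w.foldl M.step s) := by
    intro w
    induction w with
    | nil => exact fun s => rfl
    | cons c w ih => exact fun s => by simp only [List.foldl_cons, Equiv.symm_apply_apply, ih]
  rw [← hM w, DFAO.run, DFAO.run, key]
  exact congrArg M.out (e.symm_apply_apply _)

theorem value_append_singleton (w : List (Fin n → Fin q)) (c : Fin n → Fin q) (j : Fin n) :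
    value (w ++ [c]) j = q * value w j + (c j : ℕ) := by
  simp [value]

end Automatic

namespace SectionOperator

open MvPowerSeries (sec sec_pow_mul coeff_sec)
open Automatic AlgSeries

section Automata

variable {F : Type*} [Field F] {q n : ℕ}

/-- A tuple of base-`q` digits, as an exponent. -/
noncomputable def digit (c : Fin n → Fin q) : Fin n →₀ ℕ :=
  Finsupp.equivFunOnFinite.symm fun i => (c i : ℕ)

theorem digit_lt (c : Fin n → Fin q) (i : Fin n) : digit c i < q := (c i).2

theorem coeff_value_append_singleton (w : List (Fin n → Fin q)) (c : Fin n → Fin q)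
    (g : MvPowerSeries (Fin n) F) :
    coeffSeq g (value (w ++ [c])) = coeffSeq (sec q (digit c) g) (value w) := by
  rw [coeffSeq, coeffSeq, coeff_sec]
  congr 2
  ext i
  simp [value_append_singleton, digit]

theorem coeffSeq_value_nil (g : MvPowerSeries (Fin n) F) :
    coeffSeq g (value ([] : List (Fin n → Fin q))) = MvPowerSeries.constantCoeff g := by
  rw [coeffSeq, ← MvPowerSeries.coeff_zero_eq_constantCoeff_apply]
  have h0 : Finsupp.equivFunOnFinite.symm (value ([] : List (Fin n → Fin q))) = 0 := by
    ext i
    simp [value]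
  rw [h0]

variable {W : Submodule F (MvPowerSeries (Fin n) F)} {f : MvPowerSeries (Fin n) F}

/-- A finite space of power series which contains `f` and is stable under the section operators
gives an automaton in reverse reading. -/
theorem compReverse_le_card_of_stable [Finite W] (hf : f ∈ W)
    (hW : ∀ c : Fin n → Fin q, ∀ g ∈ W, sec q (digit c) g ∈ W) :
    compReverse q (coeffSeq f) ≤ (Nat.card W : ℕ∞) := by
  -- The state is the section of `f` along the digits read so far; the digits still to come index
  -- its coefficients.
  refine compReverse_le_card (σ := W) ⟨⟨f, hf⟩, fun g c => ⟨sec q (digit c) g, hW c g g.2⟩,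
    fun g => MvPowerSeries.constantCoeff g.1⟩ fun w => ?_
  have key : ∀ (w : List (Fin n → Fin q)) (g : W), MvPowerSeries.constantCoeff
      (w.reverse.foldl (fun (g : W) c => (⟨sec q (digit c) g, hW c g g.2⟩ : W)) g).1
      = coeffSeq g.1 (value w) := by
    intro w
    induction w using List.reverseRecOn with
    | nil => exact fun g => (coeffSeq_value_nil g.1).symm
    | append_singleton w c ih =>
      intro g
      rw [List.reverse_append, List.reverse_singleton, List.singleton_append, List.foldl_cons, ih,
        coeff_value_append_singleton]
  exact key w ⟨f, hf⟩

/-- A finite space of power series which contains `f` and is stable under the section operators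
gives, by duality, an automaton in direct reading. -/
theorem compDirect_le_card_of_stable [Finite F] [Finite W] (hf : f ∈ W)
    (hW : ∀ c : Fin n → Fin q, ∀ g ∈ W, sec q (digit c) g ∈ W) :
    compDirect q (coeffSeq f) ≤ (Nat.card W : ℕ∞) := by
  have hcard : Nat.card (Module.Dual F W) = Nat.card W := by
    rw [Module.natCard_eq_pow_finrank (K := F), Module.natCard_eq_pow_finrank (K := F) (V := W),
      Subspace.dual_finrank_eq]
  have : Finite (Module.Dual F W) := Module.finite_of_finite F
  rw [← hcard]
  let φ : Module.Dual F W := (MvPowerSeries.coeff 0).comp W.subtype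
  -- Transposing the sections reverses their order: digits read from the most significant end
  -- precompose the functional, so the least significant section still acts on `f` first.
  let M : DFAO (Fin n → Fin q) (Module.Dual F W) F :=
    ⟨φ, fun l c => l.comp ((sec q (digit c)).restrict (hW c)), fun l => l ⟨f, hf⟩⟩
  refine compDirect_le_card M fun w => ?_
  have key : ∀ (w : List (Fin n → Fin q)) (g : W),
      w.foldl M.step M.start g = coeffSeq g.1 (value w) := by
    intro w
    induction w using List.reverseRecOn with
    | nil => exact fun g => (coeffSeq_value_nil g.1).symm
    | append_singleton w c ih =>
      intro g
      rw [List.foldl_append, coeff_value_append_singleton]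
      exact ih _
  exact key w ⟨f, hf⟩

end Automata

/-! ### The finite stable space -/

section Box

variable {F σ ι : Type*} [Field F]

/-- The exponents of bounded degrees, for a family of degree functions. -/
def expBox (D : ι → (σ →₀ ℕ) →+ ℕ) (b : ι → ℕ) : Set (σ →₀ ℕ) := {m | ∀ i, D i m ≤ b i}

/-- The power series all of whose exponents have bounded degrees. -/
def seriesBox (F : Type*) [Field F] (D : ι → (σ →₀ ℕ) →+ ℕ) (b : ι → ℕ) :
    Submodule F (MvPowerSeries σ F) where
  carrier := {g | ∀ m, MvPowerSeries.coeff m g ≠ 0 → m ∈ expBox D b}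
  zero_mem' m h := absurd (map_zero _) h
  add_mem' {g g'} hg hg' m h := by
    by_cases h1 : MvPowerSeries.coeff m g = 0
    · exact hg' m fun h2 => h (by rw [map_add, h1, h2, add_zero])
    · exact hg m h1
  smul_mem' c g hg m h := hg m fun h' => h (by rw [map_smul, h', smul_zero])

variable {D : ι → (σ →₀ ℕ) →+ ℕ} {b b' : ι → ℕ}

theorem mul_mem_seriesBox {g g' : MvPowerSeries σ F} (hg : g ∈ seriesBox F D b)
    (hg' : g' ∈ seriesBox F D b') : g * g' ∈ seriesBox F D (b + b') := by
  classical
  intro m hm i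
  rw [MvPowerSeries.coeff_mul] at hm
  obtain ⟨⟨u, v⟩, huv, h⟩ := Finset.exists_ne_zero_of_sum_ne_zero hm
  rw [Finset.HasAntidiagonal.mem_antidiagonal] at huv
  simp only at huv h
  rw [← huv, map_add]
  exact add_le_add (hg u (left_ne_zero_of_mul h) i) (hg' v (right_ne_zero_of_mul h) i)

theorem sec_mem_seriesBox {q : ℕ} (hq : 0 < q) (r : σ →₀ ℕ) {g : MvPowerSeries σ F}
    (hg : g ∈ seriesBox F D (q • b)) : sec q r g ∈ seriesBox F D b := by
  intro m hm i
  have h := hg _ hm i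
  rw [map_add, map_nsmul, Pi.smul_apply, smul_eq_mul, smul_eq_mul] at h
  exact Nat.le_of_mul_le_mul_left ((Nat.le_add_right _ _).trans h) hq

theorem coeff_mul_mem_seriesBox {P Q : (MvPowerSeries σ F)[X]}
    (hP : ∀ j, P.coeff j ∈ seriesBox F D b) (hQ : ∀ j, Q.coeff j ∈ seriesBox F D b') (j : ℕ) :
    (P * Q).coeff j ∈ seriesBox F D (b + b') := by
  rw [coeff_mul]
  exact Submodule.sum_mem _ fun x _ => mul_mem_seriesBox (hP x.1) (hQ x.2)

theorem coeff_mul_pow_mem_seriesBox {P Q : (MvPowerSeries σ F)[X]}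
    (hP : ∀ j, P.coeff j ∈ seriesBox F D b) (hQ : ∀ j, Q.coeff j ∈ seriesBox F D b') (k j : ℕ) :
    (P * Q ^ k).coeff j ∈ seriesBox F D (b + k • b') := by
  induction k generalizing j with
  | zero => simpa using hP j
  | succ k ih =>
    rw [pow_succ, ← mul_assoc, succ_nsmul, ← add_assoc]
    exact coeff_mul_mem_seriesBox ih hQ j

/-- The power series of the form `P(f) / c` where `P` has degree less than `d` and coefficients
in a box. -/
def quotientBox (D : ι → (σ →₀ ℕ) →+ ℕ) (b : ι → ℕ) (d : ℕ) (f c : MvPowerSeries σ F) :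
    Submodule F (MvPowerSeries σ F) where
  carrier := {g | ∃ P : (MvPowerSeries σ F)[X], (∀ j, d ≤ j → P.coeff j = 0) ∧
    (∀ j, P.coeff j ∈ seriesBox F D b) ∧ g * c = P.eval f}
  zero_mem' := ⟨0, by simp, by simp, by simp⟩
  add_mem' := by
    rintro g g' ⟨P, h1, h2, h3⟩ ⟨P', h1', h2', h3'⟩
    refine ⟨P + P', fun j hj => ?_, fun j => ?_, ?_⟩
    · rw [Polynomial.coeff_add, h1 j hj, h1' j hj, add_zero]
    · rw [Polynomial.coeff_add]
      exact Submodule.add_mem _ (h2 j) (h2' j)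
    · rw [add_mul, h3, h3', eval_add]
  smul_mem' := by
    rintro a g ⟨P, h1, h2, h3⟩
    refine ⟨a • P, fun j hj => ?_, fun j => ?_, ?_⟩
    · rw [Polynomial.coeff_smul, h1 j hj, smul_zero]
    · rw [Polynomial.coeff_smul]
      exact Submodule.smul_mem _ _ (h2 j)
    · rw [smul_mul_assoc, h3, eval_smul]

variable {d : ℕ} {f c : MvPowerSeries σ F}

/-- Cancelling `c`, a chosen numerator `P` determines `g`, and `P` is determined by its coefficients
inside the box. -/
theorem exists_injective_quotientBox (hc : c ≠ 0) :
    ∃ φ : quotientBox D b d f c → (Fin d → expBox D b → F), Function.Injective φ := by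
  choose P h1 h2 h3 using fun g : quotientBox D b d f c => g.2
  refine ⟨fun g j m => MvPowerSeries.coeff m.1 ((P g).coeff j), fun g g' h => ?_⟩
  have hP : P g = P g' := by
    ext1 j
    by_cases hj : d ≤ j
    · rw [h1 g j hj, h1 g' j hj]
    · ext m
      by_cases hm : m ∈ expBox D b
      · exact congrFun (congrFun h ⟨j, not_le.1 hj⟩) ⟨m, hm⟩
      · rw [by_contra fun h => hm (h2 g j m h), by_contra fun h => hm (h2 g' j m h)]
  exact Subtype.ext (mul_right_cancel₀ hc (by rw [h3, h3, hP]))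

theorem finite_quotientBox [Finite F] (hc : c ≠ 0) [Finite (expBox D b)] :
    Finite (quotientBox D b d f c) := by
  obtain ⟨φ, hφ⟩ := exists_injective_quotientBox (D := D) (b := b) (d := d) (f := f) hc
  exact Finite.of_injective φ hφ

theorem card_quotientBox_le [Finite F] (hc : c ≠ 0) [Finite (expBox D b)] :
    Nat.card (quotientBox D b d f c) ≤ Nat.card F ^ (d * Nat.card (expBox D b)) := by
  obtain ⟨φ, hφ⟩ := exists_injective_quotientBox (D := D) (b := b) (d := d) (f := f) hc
  refine (Nat.card_le_card_of_injective φ hφ).trans (le_of_eq ?_)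
  rw [Nat.card_fun, Nat.card_fun, Nat.card_fin, ← pow_mul, mul_comm]

variable {E : (MvPowerSeries σ F)[X]}

theorem self_mem_quotientBox (hEb : ∀ j, E.coeff j ∈ seriesBox F D b) (hE : E.eval f = 0) :
    f ∈ quotientBox D b E.natDegree f ((derivative E).eval f) := by
  have hcoeff : ∀ j : ℕ, (X * derivative E).coeff j = (j : F) • E.coeff j := fun j => by
    cases j with
    | zero => simp
    | succ j =>
      rw [coeff_X_mul, coeff_derivative, MvPowerSeries.smul_eq_C_mul, mul_comm]
      push_cast
      simp
  -- Subtracting `deg E` times `E` removes the leading term of `y * E_y` without changing its value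
  -- at `f`.
  refine ⟨X * derivative E - (E.natDegree : F) • E, fun j hj => ?_, fun j => ?_, ?_⟩
  · rw [Polynomial.coeff_sub, hcoeff, Polynomial.coeff_smul]
    rcases hj.eq_or_lt with rfl | hj
    · exact sub_self _
    · rw [coeff_eq_zero_of_natDegree_lt hj, smul_zero, smul_zero, sub_zero]
  · rw [Polynomial.coeff_sub, hcoeff, Polynomial.coeff_smul]
    exact Submodule.sub_mem _ (Submodule.smul_mem _ _ (hEb j)) (Submodule.smul_mem _ _ (hEb j))
  · rw [eval_sub, eval_mul, eval_X, eval_smul, hE, smul_zero, sub_zero]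

theorem sec_mem_quotientBox [Finite F] {q : ℕ} (hq : Nat.card F = q) {r : σ →₀ ℕ}
    (hr : ∀ i, r i < q) (hEb : ∀ j, E.coeff j ∈ seriesBox F D b) (hE : E.eval f = 0)
    {g : MvPowerSeries σ F} (hg : g ∈ quotientBox D b E.natDegree f ((derivative E).eval f)) :
    sec q r g ∈ quotientBox D b E.natDegree f ((derivative E).eval f) := by
  have hq0 : 0 < q := by rw [← hq]; exact Nat.card_pos
  obtain ⟨P, h1, h2, h3⟩ := hg
  refine ⟨secPoly q r (P * E ^ (q - 1)), fun j hj => ?_, fun j => ?_,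
    sec_mul_derivative hq hr hE h3⟩
  -- With `d = deg E`, the degree of `P * E ^ (q - 1)` is below `q * d`, while `j ≥ d` asks for its
  -- coefficient at `q * j + (q - 1) ≥ q * d`.
  · rw [coeff_secPoly hq0, coeff_mul, Finset.sum_eq_zero, map_zero]
    rintro ⟨u, v⟩ huv
    rw [Finset.HasAntidiagonal.mem_antidiagonal] at huv
    simp only at huv ⊢
    rcases le_or_gt E.natDegree u with hu | hu
    · rw [h1 u hu, zero_mul]
    · rw [coeff_eq_zero_of_natDegree_lt (p := E ^ (q - 1)), mul_zero]
      refine natDegree_pow_le.trans_lt ?_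
      obtain ⟨q, rfl⟩ : ∃ q', q = q' + 1 := ⟨q - 1, by omega⟩
      have := Nat.mul_le_mul_left q hj
      rw [Nat.add_sub_cancel] at huv ⊢
      rw [add_mul, one_mul] at huv
      omega
  · rw [coeff_secPoly hq0]
    refine sec_mem_seriesBox hq0 r ?_
    -- The product has box `b + (q - 1) • b = q • b`, which the section shrinks back to `b`.
    have := coeff_mul_pow_mem_seriesBox h2 hEb (q - 1) (q * j + (q - 1))
    rwa [← succ_nsmul', Nat.sub_add_cancel hq0] at this

end Box

end SectionOperator

/-! ### Counting exponents and conclusion -/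

namespace SectionOperator

open Automatic AlgSeries

variable {F : Type*} [Field F] {n : ℕ}

theorem card_expBox_partial (b : Fin n → ℕ) :
    Finite (expBox (fun i : Fin n => Finsupp.applyAddHom (M := ℕ) i) b) ∧
      Nat.card (expBox (fun i : Fin n => Finsupp.applyAddHom (M := ℕ) i) b) ≤ ∏ i, (b i + 1) := by
  let φ : expBox (fun i : Fin n => Finsupp.applyAddHom (M := ℕ) i) b → ∀ i, Fin (b i + 1) :=
    fun m i => ⟨m.1 i, Nat.lt_succ_iff.2 (m.2 i)⟩
  have hφ : Function.Injective φ := fun m m' h =>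
    Subtype.ext (Finsupp.ext fun i => congrArg Fin.val (congrFun h i))
  refine ⟨Finite.of_injective φ hφ, (Nat.card_le_card_of_injective φ hφ).trans (le_of_eq ?_)⟩
  simp

theorem card_expBox_degree (h : ℕ) :
    Finite (expBox (fun _ : Unit => (Finsupp.degree : (Fin n →₀ ℕ) →+ ℕ)) fun _ => h) ∧
      Nat.card (expBox (fun _ : Unit => (Finsupp.degree : (Fin n →₀ ℕ) →+ ℕ)) fun _ => h)
        ≤ (n + h).choose n := by
  -- A slack entry `h - |m|` turns the bound on the degree into an equality in `n + 1` variables.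
  let φ : expBox (fun _ : Unit => (Finsupp.degree : (Fin n →₀ ℕ) →+ ℕ)) (fun _ => h) →
      Finset.finsuppAntidiag (Finset.univ : Finset (Fin (n + 1))) h :=
    fun m => ⟨Finsupp.cons (h - m.1.degree) m.1, by
      rw [Finset.mem_finsuppAntidiag]
      refine ⟨?_, Finset.subset_univ _⟩
      have := m.2 ()
      rw [Fin.sum_univ_succ]
      simp only [Finsupp.cons_zero, Finsupp.cons_succ]
      rw [← Finsupp.degree_eq_sum]
      exact Nat.sub_add_cancel this⟩
  have hφ : Function.Injective φ := fun m m' hm =>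
    Subtype.ext (Finsupp.cons_injective2 (congrArg Subtype.val hm)).2
  refine ⟨Finite.of_injective φ hφ, (Nat.card_le_card_of_injective φ hφ).trans (le_of_eq ?_)⟩
  rw [Nat.card_eq_fintype_card, Fintype.card_coe, Finset.card_finsuppAntidiag_nat_eq_choose,
    Finset.card_univ, Fintype.card_fin, Nat.add_right_comm, Nat.add_sub_cancel,
    Nat.choose_symm_add]

/-- Bounds for both state complexities, for an annihilating polynomial with coefficients in a given
box. -/
theorem comp_le_of_coeff_mem [Finite F] {ι : Type*} {D : ι → (Fin n →₀ ℕ) →+ ℕ} {b : ι → ℕ}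
    [Finite (expBox D b)] {f : MvPowerSeries (Fin n) F} {E : (MvPowerSeries (Fin n) F)[X]}
    (hEb : ∀ j, E.coeff j ∈ seriesBox F D b) (hE : E.eval f = 0)
    (hder : (derivative E).eval f ≠ 0) {K : ℕ} (hK : Nat.card (expBox D b) ≤ K) :
    compReverse (Nat.card F) (coeffSeq f) ≤ ((Nat.card F ^ (E.natDegree * K) : ℕ) : ℕ∞) ∧
      compDirect (Nat.card F) (coeffSeq f) ≤ ((Nat.card F ^ (E.natDegree * K) : ℕ) : ℕ∞) := by
  have := finite_quotientBox (D := D) (b := b) (d := E.natDegree) (f := f) hder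
  have hcard : Nat.card (quotientBox D b E.natDegree f ((derivative E).eval f))
      ≤ Nat.card F ^ (E.natDegree * K) :=
    (card_quotientBox_le hder).trans
      (Nat.pow_le_pow_right Nat.card_pos (Nat.mul_le_mul_left _ hK))
  have hf := self_mem_quotientBox hEb hE
  have hsec := fun (c : Fin n → Fin (Nat.card F)) g
    (hg : g ∈ quotientBox D b E.natDegree f ((derivative E).eval f)) =>
    sec_mem_quotientBox rfl (digit_lt c) hEb hE hg
  exact ⟨(compReverse_le_card_of_stable hf hsec).trans (Nat.cast_le.2 hcard),
    (compDirect_le_card_of_stable hf hsec).trans (Nat.cast_le.2 hcard)⟩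

end SectionOperator

open SectionOperator

theorem theorem2 {F : Type*} [Field F] [Finite F] (q : ℕ) (hq : Nat.card F = q) (n : ℕ)
    (f : MvPowerSeries (Fin n) F) (hf : IsAlgebraic (MvPolynomial (Fin n) F) f)
    (d h : ℕ) (hp : Fin n → ℕ) (N N' : ℕ)
    (hd : d = AlgSeries.degree f)
    (hh : h = AlgSeries.totalHeight f)
    (hhp : ∀ i, hp i = AlgSeries.partialHeight f i)
    (hN : N = d * min (∏ i, (hp i + 1)) ((n + h).choose n))
    (hN' : N' = (d + 1) * min (∏ i, (hp i + 1)) ((n + h).choose n)) :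
    Automatic.compReverse q (AlgSeries.coeffSeq f) ≤ ((1 + q ^ N : ℕ) : ℕ∞) ∧
      Automatic.compDirect q (AlgSeries.coeffSeq f) ≤ ((q ^ N' : ℕ) : ℕ∞) := by
  have : IsDomain (MvPowerSeries (Fin n) F) := NoZeroDivisors.to_isDomain _
  obtain ⟨E, hE0, hEf, hdvd⟩ := exists_dvd_of_aeval_eq_zero algebraMap_injective hf
  have hne : (AlgSeries.annihilators f).Nonempty := ⟨E, hE0, hEf⟩
  have hdeg : E.natDegree ≤ d := by
    rw [hd]
    refine le_csInf (hne.image _) ?_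
    rintro _ ⟨A, ⟨hA0, hA⟩, rfl⟩
    exact natDegree_le_of_dvd (hdvd A hA) hA0
  have hpart : ∀ i, AlgSeries.degT i E ≤ hp i := fun i => by
    rw [hhp]
    refine le_csInf (hne.image _) ?_
    rintro _ ⟨A, ⟨hA0, hA⟩, rfl⟩
    exact AlgSeries.degT_le_of_dvd i hA0 (hdvd A hA)
  have htot : AlgSeries.totalDegT E ≤ h := by
    rw [hh]
    refine le_csInf (hne.image _) ?_
    rintro _ ⟨A, ⟨hA0, hA⟩, rfl⟩
    exact AlgSeries.totalDegT_le_of_dvd hA0 (hdvd A hA)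
  have hq0 : 0 < q := hq ▸ Nat.card_pos
  set E' : (MvPowerSeries (Fin n) F)[X] := E.map (algebraMap _ _) with hE'
  have hcoeff : ∀ j, E'.coeff j = (E.coeff j : MvPowerSeries (Fin n) F) := fun j => by
    rw [hE', coeff_map, algebraMap_eq_coe]
  have hE'f : E'.eval f = 0 := by rw [hE', eval_map_algebraMap, hEf]
  have hder : (derivative E').eval f ≠ 0 := by
    rw [hE', derivative_map, eval_map_algebraMap]
    exact aeval_derivative_ne_zero hE0 hEf hdvd
  have hdeg' : E'.natDegree ≤ d := natDegree_map_le.trans hdeg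
  have hsupp : ∀ j m, MvPowerSeries.coeff m (E'.coeff j) ≠ 0 →
      j ∈ E.support ∧ m ∈ (E.coeff j).support := fun j m hm => by
    rw [hcoeff, MvPolynomial.coeff_coe] at hm
    refine ⟨mem_support_iff.2 fun h => hm ?_, MvPolynomial.mem_support_iff.2 hm⟩
    rw [h, MvPolynomial.coeff_zero]
  have hbox : ∀ j, E'.coeff j ∈
      seriesBox F (fun i : Fin n => Finsupp.applyAddHom (M := ℕ) i) hp := fun j m hm i => by
    obtain ⟨hj, hm⟩ := hsupp j m hm
    exact (MvPolynomial.le_degreeOf_of_mem_support i hm).trans ((Finset.le_sup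
      (f := fun j => (E.coeff j).degreeOf i) hj).trans (hpart i))
  have hbox' : ∀ j, E'.coeff j ∈
      seriesBox F (fun _ : Unit => (Finsupp.degree : (Fin n →₀ ℕ) →+ ℕ)) fun _ => h :=
    fun j m hm _ => by
    obtain ⟨hj, hm⟩ := hsupp j m hm
    exact (MvPolynomial.le_totalDegree hm).trans ((Finset.le_sup
      (f := fun j => (E.coeff j).totalDegree) hj).trans htot)
  obtain ⟨hfin, hcard⟩ := card_expBox_partial hp
  obtain ⟨hfin', hcard'⟩ := card_expBox_degree (n := n) h
  have key : Automatic.compReverse q (AlgSeries.coeffSeq f) ≤ ((q ^ N : ℕ) : ℕ∞) ∧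
      Automatic.compDirect q (AlgSeries.coeffSeq f) ≤ ((q ^ N : ℕ) : ℕ∞) := by
    have hmono : ((q ^ (E'.natDegree * min (∏ i, (hp i + 1)) ((n + h).choose n)) : ℕ) : ℕ∞)
        ≤ ((q ^ N : ℕ) : ℕ∞) := by
      rw [hN]
      exact Nat.cast_le.2 (Nat.pow_le_pow_right hq0 (Nat.mul_le_mul_right _ hdeg'))
    -- The same `E` fits both boxes, so whichever is smaller may be used.
    rcases min_choice (∏ i, (hp i + 1)) ((n + h).choose n) with hmin | hmin
    · rw [hmin] at hmono
      have := comp_le_of_coeff_mem hbox hE'f hder hcard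
      rw [hq] at this
      exact ⟨this.1.trans hmono, this.2.trans hmono⟩
    · rw [hmin] at hmono
      have := comp_le_of_coeff_mem hbox' hE'f hder hcard'
      rw [hq] at this
      exact ⟨this.1.trans hmono, this.2.trans hmono⟩
  refine ⟨key.1.trans (Nat.cast_le.2 (Nat.le_add_left _ _)), key.2.trans (Nat.cast_le.2 ?_)⟩
  rw [hN, hN']
  exact Nat.pow_le_pow_right hq0 (Nat.mul_le_mul_right _ (Nat.le_succ d))
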